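/- Let $0<q<1$ and $\lambda>0$. Let $T^q_\lambda$ be the edge-weighted Galton--Watson tree with root $\phi$ in which the offspring of the different individuals are independent and identically distributed, and each individual has one child for every point of an inhomogeneous Poisson process on $[0,\lambda]$ with intensity $q t^{q-1}$ at $t$, the position of the point being the cost of the edge to that child. For an edge from a vertex $u$ to its child $v$ (written $u\to v$) let $\ell(u,v)$ be its cost. A game valuation (of the game Exploration with quitting penalty $\lambda/2$) on $T^q_\lambda$ is a function $f:V(T^q_\lambda)\to[-\lambda/2,\lambda/2]$ such that for every vertex $u$ $$f(u)=\min\Big(\frac{\lambda}{2},\ \min_{v:\,u\to v}\big[\ell(u,v)-f(v)\big]\Big),$$ where the inner minimum is omitted if $u$ has no children. Then almost surely there is exactly one game valuation on $T^q_\lambda$. Equivalently, order the functions on $V(T^q_\lambda)$ by letting $f\preceq g$ if $f(u)\le g(u)$ for every $u$ at even distance from $\phi$ and $f(u)\ge g(u)$ for every $u$ at odd distance from $\phi$; then almost surely there are a smallest game valuation $f_A$ and a largest game valuation $f_B$ with respect to $\preceq$, and $f_A=f_B$. -/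

import Mathlib

open MeasureTheory ProbabilityTheory

/-! ### Finite point configurations and Poisson processes -/

/-- A finite sequence of real points: `c = (n, x)` stands for the points `x 0, …, x (n - 1)`, in
some enumeration; the values `x i` with `n ≤ i` carry no meaning. -/
abbrev PointConfig : Type := ℕ × (ℕ → ℝ)

/-- The number of points (with multiplicity) of the configuration `c` in the set `B`. -/
noncomputable def PointConfig.count (B : Set ℝ) (c : PointConfig) : ℕ :=
  ∑ i ∈ Finset.range c.1, B.indicator (fun _ => 1) (c.2 i)

/-- The random finite point configuration `η` is a Poisson process on `ℝ` with finite intensity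
measure `m`: the number of points in a Borel set `B` is Poisson distributed with mean `m B`, and
the numbers of points in pairwise disjoint Borel sets are independent. -/
structure IsPoissonProcess {Ω : Type*} [MeasurableSpace Ω] (m : Measure ℝ)
    (η : Ω → PointConfig) (P : Measure Ω) : Prop where
  isFiniteMeasure : IsFiniteMeasure m
  measurable : Measurable η
  count_hasLaw : ∀ B : Set ℝ, MeasurableSet B →
    HasLaw (fun ω => (η ω).count B) (poissonMeasure (m B).toNNReal) P
  count_iIndepFun : ∀ (k : ℕ) (B : Fin k → Set ℝ), (∀ j, MeasurableSet (B j)) →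
    Pairwise (fun i j => Disjoint (B i) (B j)) →
    iIndepFun (fun (j : Fin k) ω => (η ω).count (B j)) P

/-! ### Edge-weighted rooted trees -/

/-- A locally finite edge-weighted rooted tree in Ulam–Harris notation. Individuals are labelled by
finite words: `[]` is the root and `i :: u` is the `i`-th child of `u`. If `T u = (n, x)`, then `u`
has the `n` children `i :: u`, `i < n`, and the edge from `u` to `i :: u` has cost `x i`. -/
abbrev WeightedTree : Type := List ℕ → PointConfig

namespace WeightedTree

/-- The number of offspring of the individual with label `u`. -/
def numChildren (T : WeightedTree) (u : List ℕ) : ℕ := (T u).1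

/-- The cost of the edge from `u` to its `i`-th child. -/
def cost (T : WeightedTree) (u : List ℕ) (i : ℕ) : ℝ := (T u).2 i

/-- The labels that really occur in the tree. -/
def IsVertex (T : WeightedTree) : List ℕ → Prop
  | [] => True
  | i :: u => T.IsVertex u ∧ i < T.numChildren u

/-- The vertex set of the tree. -/
def Vertex (T : WeightedTree) : Type := {u : List ℕ // T.IsVertex u}

/-- The `i`-th child of the vertex `u`. -/
def Vertex.child {T : WeightedTree} (u : T.Vertex) (i : Fin (T.numChildren u.1)) : T.Vertex :=
  ⟨i.1 :: u.1, u.2, i.2⟩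

/-- The distance of the vertex `u` from the root. -/
def Vertex.depth {T : WeightedTree} (u : T.Vertex) : ℕ := u.1.length

/-- Game valuations of Exploration with quitting penalty `lam / 2`: functions on the vertices with
values in `[-lam / 2, lam / 2]` such that, at every vertex `u`, the value `f u` is the minimum of
the penalty `lam / 2` (quitting) and the numbers `ℓ(u, v) - f v`, over the children `v` of `u`
(moving to `v`). -/
def IsGameValuation (T : WeightedTree) (lam : ℝ) (f : T.Vertex → ℝ) : Prop :=
  ∀ u : T.Vertex, f u ∈ Set.Icc (-(lam / 2)) (lam / 2) ∧
    IsLeast (insert (lam / 2)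
      (Set.range fun i : Fin (T.numChildren u.1) => T.cost u.1 i - f (u.child i))) (f u)

/-- The alternating order on functions on the vertices: `f ≤ g` at even distance from the root and
`g ≤ f` at odd distance from the root. -/
def AltLE (T : WeightedTree) (f g : T.Vertex → ℝ) : Prop :=
  ∀ u : T.Vertex, (Even u.depth → f u ≤ g u) ∧ (Odd u.depth → g u ≤ f u)

/-- `f` is the valuation `f_A` that is the most optimistic one for Alice, who moves first: the
smallest game valuation in the alternating order. -/
def IsAliceValuation (T : WeightedTree) (lam : ℝ) (f : T.Vertex → ℝ) : Prop :=
  T.IsGameValuation lam f ∧ ∀ g : T.Vertex → ℝ, T.IsGameValuation lam g → T.AltLE f g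

/-- `f` is the valuation `f_B` that is the most optimistic one for Bob, who moves second: the
largest game valuation in the alternating order. -/
def IsBobValuation (T : WeightedTree) (lam : ℝ) (f : T.Vertex → ℝ) : Prop :=
  T.IsGameValuation lam f ∧ ∀ g : T.Vertex → ℝ, T.IsGameValuation lam g → T.AltLE g f

end WeightedTree

/-! ### The Poisson-weighted Galton–Watson tree -/

/-- The measure with density `q * t ^ (q - 1)` on `[0, lam]`. -/
noncomputable def offspringIntensity (q lam : ℝ) : Measure ℝ :=
  (volume.restrict (Set.Icc 0 lam)).withDensity fun t => ENNReal.ofReal (q * t ^ (q - 1))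

/-- The random edge-weighted tree `T` (with `T u ω` the offspring of the individual `u`) is the
Poisson-weighted Galton–Watson tree `T^q_lam`: the offspring of the different individuals are
independent and identically distributed, and the edge costs to the children of each individual form
a Poisson process on `[0, lam]` with intensity `q * t ^ (q - 1)` at `t`. The children of an
individual may be enumerated in any order (for example by increasing edge cost). -/
structure IsPoissonGaltonWatsonTree {Ω : Type*} [MeasurableSpace Ω] (q lam : ℝ)
    (T : List ℕ → Ω → PointConfig) (P : Measure Ω) : Prop where
  isPoissonProcess : ∀ u : List ℕ, IsPoissonProcess (offspringIntensity q lam) (T u) P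
  identDistrib : ∀ u : List ℕ, IdentDistrib (T u) (T []) P P
  iIndepFun : iIndepFun T P

/-- The realization at the sample point `ω` of a random family of offspring configurations. -/
def treeAt {Ω : Type*} (T : List ℕ → Ω → PointConfig) (ω : Ω) : WeightedTree := fun u => T u ω

/-! Put `h = lam / 2`. Cutting the tree at generation `n` and assigning the extreme values `-h` or
`h` there gives bounds for every game valuation. They are monotone in `n` and converge to
`lowerValue` `L ≤ U` `upperValue`, so it suffices that `L = U` almost surely at every vertex. Since
a move swaps the players, `L` at the root is computed from `U` at the children, and `U` from `L`.
Let `μ`, `ν` be the laws of `L`, `U`, let `m` be the intensity, and let `J_ν(x)` be the `ν`-mean of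
`m(-∞, x + s)` (`potential`). By the Poisson property, `P(L ≥ x) = exp(-J_ν(x))` and `P(U ≥ x) =
exp(-J_μ(x))` for `-h < x ≤ h` (`measureReal_Ici_map_of_eq_moveValue`). Hence `J_ν(L)` is
distributed as an Exp(1) variable capped at `J_ν(h)` and has mean `1 - exp(-J_ν(h))`; likewise for
`J_μ(U)`. These means coincide, because `m(-∞, x + s)` is symmetric in `x` and `s`. So `J_ν(h) =
J_μ(h)` (`potential_eq_of_tails`), that is, `m(-∞, h + L)` and `m(-∞, h + U)` have the same mean. As
`L ≤ U` and `m` charges every subinterval of `[0, 2h]`, `L = U` almost surely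
(`ae_eq_of_potential_eq`). -/

/-! ### Generating functional of a Poisson process. -/

lemma PointConfig.prod_pow_count {k : ℕ} (B : Fin k → Set ℝ) (a : Fin k → ℝ) (g : ℝ → ℝ)
    (hg : ∀ j, ∀ t ∈ B j, g t = a j) (hB : Pairwise fun i j => Disjoint (B i) (B j))
    (hcov : ∀ t, ∃ j, t ∈ B j) (c : PointConfig) :
    ∏ j, a j ^ c.count (B j) = ∏ i ∈ Finset.range c.1, g (c.2 i) := by
  simp_rw [PointConfig.count, ← Finset.prod_pow_eq_pow_sum]
  rw [Finset.prod_comm]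
  refine Finset.prod_congr rfl fun i _ => ?_
  obtain ⟨j, hj⟩ := hcov (c.2 i)
  rw [Finset.prod_eq_single j, hg j _ hj]
  · simp [hj]
  · intro l _ hl
    have : c.2 i ∉ B l := fun h => Set.disjoint_left.1 (hB hl) h hj
    simp [this]
  · simp

lemma integral_pow_poissonMeasure (r : NNReal) (a : ℝ) :
    ∫ n, a ^ n ∂(poissonMeasure r) = Real.exp (-(r * (1 - a))) := by
  rw [integral_poissonMeasure]
  have h := (NormedSpace.expSeries_div_hasSum_exp (r * a : ℝ)).mul_left (Real.exp (-r))
  rw [← Real.exp_eq_exp_ℝ, ← Real.exp_add] at h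
  have hexp : -(r * (1 - a) : ℝ) = -r + r * a := by ring
  rw [hexp, ← h.tsum_eq]
  refine tsum_congr fun n => ?_
  rw [smul_eq_mul, mul_pow]
  ring

lemma PointConfig.measurable_count {B : Set ℝ} (hB : MeasurableSet B) :
    Measurable (PointConfig.count B) := by
  refine measurable_from_prod_countable_right fun n => ?_
  simp only [PointConfig.count]
  refine Finset.measurable_sum _ fun i _ => ?_
  exact (measurable_const.indicator hB).comp (measurable_pi_apply i)

lemma PointConfig.measurable_prod {g : ℝ → ℝ} (hg : Measurable g) :
    Measurable fun c : PointConfig => ∏ i ∈ Finset.range c.1, g (c.2 i) := by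
  refine measurable_from_prod_countable_right fun n => ?_
  simp only
  exact Finset.measurable_prod _ fun i _ => hg.comp (measurable_pi_apply i)

section PoissonProcess

variable {Ω : Type*} [MeasurableSpace Ω] {P : Measure Ω} {m : Measure ℝ} {η : Ω → PointConfig}

namespace IsPoissonProcess

/-- For a simple function the product over the points is a product of powers `a j ^ N j` with
independent Poisson counts `N j`, so the expectation factors into Poisson generating functions. -/
lemma integral_prod_of_partition (hη : IsPoissonProcess m η P) {k : ℕ} (B : Fin k → Set ℝ)
    (hBm : ∀ j, MeasurableSet (B j)) (a : Fin k → ℝ) (g : ℝ → ℝ)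
    (hg : ∀ j, ∀ t ∈ B j, g t = a j) (hB : Pairwise fun i j => Disjoint (B i) (B j))
    (hcov : ∀ t, ∃ j, t ∈ B j) :
    ∫ ω, ∏ i ∈ Finset.range (η ω).1, g ((η ω).2 i) ∂P = Real.exp (-∫ t, (1 - g t) ∂m) := by
  have := hη.isFiniteMeasure
  simp_rw [← PointConfig.prod_pow_count B a g hg hB hcov]
  rw [iIndepFun.integral_fun_prod_comp (X := fun (j : Fin k) ω => (η ω).count (B j))
    (f := fun j n => a j ^ n) (hη.count_iIndepFun k B hBm hB)
    (fun j => ((PointConfig.measurable_count (hBm j)).comp hη.measurable).aemeasurable)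
    (fun j => by fun_prop)]
  have h1 : ∀ j, ∫ ω, a j ^ (η ω).count (B j) ∂P = Real.exp (-(m.real (B j) * (1 - a j))) := by
    intro j
    have h := (hη.count_hasLaw (B j) (hBm j)).integral_comp (f := fun n : ℕ => a j ^ n)
      (by fun_prop)
    simp only [Function.comp_def] at h
    rw [h, integral_pow_poissonMeasure]
    rfl
  simp_rw [h1]
  rw [← Real.exp_sum, Finset.sum_neg_distrib]
  congr 2
  have hu : (⋃ j, B j) = Set.univ := Set.eq_univ_of_forall fun t => Set.mem_iUnion.2 (hcov t)
  have hind : ∀ t, 1 - g t = ∑ j, (B j).indicator (fun _ => 1 - a j) t := by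
    intro t
    obtain ⟨j, hj⟩ := hcov t
    rw [Finset.sum_eq_single j, hg j t hj]
    · simp [hj]
    · intro l _ hl
      have : t ∉ B l := fun h => Set.disjoint_left.1 (hB hl) h hj
      simp [this]
    · simp
  simp_rw [hind]
  rw [integral_finsetSum _ fun j _ => (integrable_const _).indicator (hBm j)]
  refine Finset.sum_congr rfl fun j _ => ?_
  rw [integral_indicator_const _ (hBm j), smul_eq_mul]

lemma integral_prod_eq_exp [IsProbabilityMeasure P] (hη : IsPoissonProcess m η P) {g : ℝ → ℝ}
    (hgm : Measurable g) (hg : ∀ t, g t ∈ Set.Icc 0 1) :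
    ∫ ω, ∏ i ∈ Finset.range (η ω).1, g ((η ω).2 i) ∂P = Real.exp (-∫ t, (1 - g t) ∂m) := by
  have := hη.isFiniteMeasure
  -- `g` rounded down to a multiple of `1 / (n + 1)`: a simple function to which the partition
  -- formula applies.
  set G : ℕ → ℝ → ℝ := fun n t => (⌊(n + 1 : ℝ) * g t⌋₊ : ℝ) / (n + 1) with hG
  have hpos : ∀ n : ℕ, (0 : ℝ) < n + 1 := fun n => by positivity
  have hG0 : ∀ n t, 0 ≤ G n t := fun n t => by positivity
  have hGle : ∀ n t, G n t ≤ g t := fun n t => by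
    rw [hG, div_le_iff₀ (hpos n), mul_comm (g t)]
    exact Nat.floor_le (mul_nonneg (hpos n).le (hg t).1)
  have hG1 : ∀ n t, G n t ≤ 1 := fun n t => (hGle n t).trans (hg t).2
  have hGm : ∀ n, Measurable (G n) := fun n => by
    have : Measurable fun t => ⌊(n + 1 : ℝ) * g t⌋₊ := Nat.measurable_floor.comp (by fun_prop)
    fun_prop
  have hGlim : ∀ t, Filter.Tendsto (fun n => G n t) Filter.atTop (nhds (g t)) := fun t => by
    have hlow : ∀ n : ℕ, g t - 1 / ((n : ℝ) + 1) ≤ G n t := fun n => by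
      rw [hG, sub_le_iff_le_add, ← add_div, le_div_iff₀ (hpos n), mul_comm]
      exact (Nat.lt_floor_add_one _).le
    refine tendsto_of_tendsto_of_tendsto_of_le_of_le ?_ tendsto_const_nhds hlow (hGle · t)
    simpa using tendsto_const_nhds.sub (tendsto_one_div_add_atTop_nhds_zero_nat (𝕜 := ℝ))
  have hstep : ∀ n, ∫ ω, ∏ i ∈ Finset.range (η ω).1, G n ((η ω).2 i) ∂P
      = Real.exp (-∫ t, (1 - G n t) ∂m) := fun n => by
    -- The floor takes the values `0, …, n + 1`; the last one occurs where `g t = 1`.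
    refine hη.integral_prod_of_partition (k := n + 2)
      (fun j => {t | ⌊(n + 1 : ℝ) * g t⌋₊ = j.1}) (fun j => ?_)
      (fun j => (j.1 : ℝ) / (n + 1)) _ ?_ ?_ ?_
    · have : Measurable fun t => ⌊(n + 1 : ℝ) * g t⌋₊ := Nat.measurable_floor.comp (by fun_prop)
      exact this (measurableSet_singleton _)
    · intro j t ht
      simp only [Set.mem_ofPred_eq] at ht
      simp [hG, ht]
    · intro i j hij
      refine Set.disjoint_left.2 fun t hi hj => hij (Fin.ext ?_)
      exact hi.symm.trans hj
    · intro t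
      refine ⟨⟨⌊(n + 1 : ℝ) * g t⌋₊, ?_⟩, rfl⟩
      have h1 : (n + 1 : ℝ) * g t ≤ ((n + 1 : ℕ) : ℝ) := by
        push_cast
        exact mul_le_of_le_one_right (hpos n).le (hg t).2
      exact Nat.lt_succ_iff.2 ((Nat.floor_mono h1).trans (Nat.floor_natCast _).le)
  have hleft : Filter.Tendsto (fun n => ∫ ω, ∏ i ∈ Finset.range (η ω).1, G n ((η ω).2 i) ∂P)
      Filter.atTop (nhds (∫ ω, ∏ i ∈ Finset.range (η ω).1, g ((η ω).2 i) ∂P)) := by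
    refine tendsto_integral_of_dominated_convergence (fun _ => 1) (fun n => ?_)
      (integrable_const _) (fun n => ?_) ?_
    · exact ((PointConfig.measurable_prod (hGm n)).comp hη.measurable).aestronglyMeasurable
    · refine .of_forall fun ω => ?_
      rw [Real.norm_of_nonneg (Finset.prod_nonneg fun _ _ => hG0 _ _)]
      exact Finset.prod_le_one (fun _ _ => hG0 _ _) fun _ _ => hG1 _ _
    · exact .of_forall fun ω => tendsto_finsetProd _ fun i _ => hGlim _
  have hright : Filter.Tendsto (fun n => Real.exp (-∫ t, (1 - G n t) ∂m)) Filter.atTop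
      (nhds (Real.exp (-∫ t, (1 - g t) ∂m))) := by
    refine (Real.continuous_exp.tendsto _).comp (Filter.Tendsto.neg ?_)
    refine tendsto_integral_of_dominated_convergence (fun _ => 1) (fun n => ?_)
      (integrable_const _) (fun n => ?_) ?_
    · exact (measurable_const.sub (hGm n)).aestronglyMeasurable
    · refine .of_forall fun t => ?_
      rw [Real.norm_of_nonneg (sub_nonneg.2 (hG1 n t))]
      linarith [hG0 n t]
    · exact .of_forall fun t => tendsto_const_nhds.sub (hGlim t)
  simp_rw [hstep] at hleft
  exact tendsto_nhds_unique hleft hright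

lemma ae_forall_notMem (hη : IsPoissonProcess m η P) {B : Set ℝ} (hB : MeasurableSet B)
    (h0 : m B = 0) : ∀ᵐ ω ∂P, ∀ i < (η ω).1, (η ω).2 i ∉ B := by
  have hlaw := hη.count_hasLaw B hB
  have h1 : ∀ᵐ ω ∂P, (η ω).count B = 0 := by
    have h2 : ∀ᵐ n ∂(poissonMeasure (m B).toNNReal), n = 0 := by
      rw [ae_iff, ← prob_compl_eq_one_iff (by measurability)]
      have : {a : ℕ | ¬a = 0}ᶜ = {0} := by ext; simp
      rw [this, poissonMeasure_singleton]
      simp [h0]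
    rw [← hlaw.map_eq] at h2
    exact ae_of_ae_map hlaw.aemeasurable h2
  filter_upwards [h1] with ω hω i hi hmem
  have := (Finset.sum_eq_zero_iff.1 hω) i (Finset.mem_range.2 hi)
  simp [hmem] at this

end IsPoissonProcess

end PoissonProcess

/-! ### Properties of the intensity measure. -/

lemma offspringIntensity_Iio_zero (q lam : ℝ) : offspringIntensity q lam (Set.Iio 0) = 0 := by
  refine withDensity_absolutelyContinuous _ _ ?_
  rw [Measure.restrict_apply measurableSet_Iio]
  have : Set.Iio (0 : ℝ) ∩ Set.Icc 0 lam = ∅ := by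
    ext t; simp only [Set.mem_inter_iff, Set.mem_Iio, Set.mem_Icc, Set.mem_empty_iff_false]
    grind
  simp [this]

instance offspringIntensity.nullSingletonClass (q lam : ℝ) :
    NullSingletonClass (offspringIntensity q lam) := by
  unfold offspringIntensity
  infer_instance

lemma offspringIntensity_Ico_pos {q lam a b : ℝ} (hq : 0 < q) (ha : 0 ≤ a) (hab : a < b)
    (hb : b ≤ lam) : 0 < offspringIntensity q lam (Set.Ico a b) := by
  rw [pos_iff_ne_zero, offspringIntensity, Ne, withDensity_apply_eq_zero (by fun_prop)]
  intro h
  have hsub : Set.Ioo a b ⊆ {t | ENNReal.ofReal (q * t ^ (q - 1)) ≠ 0} ∩ Set.Ico a b := by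
    intro t ht
    refine ⟨?_, ht.1.le, ht.2⟩
    have : 0 < t := ha.trans_lt ht.1
    have : 0 < q * t ^ (q - 1) := by positivity
    simpa using this
  have h2 := measure_mono_null hsub h
  rw [Measure.restrict_apply measurableSet_Ioo, Set.inter_eq_left.2] at h2
  · simp at h2
    linarith
  · exact fun t ht => ⟨ha.trans ht.1.le, ht.2.le.trans hb⟩

/-! ### Potentials and the comparison of two laws. -/

/-- Under `μ` the variable `J` is distributed as an Exp(1) variable capped at `J h`; integrating its
tail `exp (-t)` over `(0, J h]` gives the mean. -/
lemma integral_eq_one_sub_exp_neg {μ : Measure ℝ} [IsProbabilityMeasure μ] {h : ℝ} (hh : 0 ≤ h)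
    (hμ : ∀ᵐ x ∂μ, x ∈ Set.Icc (-h) h) {J : ℝ → ℝ} (hJc : Continuous J) (hJm : Monotone J)
    (hJ0 : J (-h) = 0) (htail : ∀ x ∈ Set.Icc (-h) h, μ.real (Set.Ici x) = Real.exp (-J x)) :
    ∫ x, J x ∂μ = 1 - Real.exp (-J h) := by
  have hmem : ∀ᵐ x ∂μ, 0 ≤ J x ∧ J x ≤ J h := by
    filter_upwards [hμ] with x hx
    exact ⟨hJ0 ▸ hJm hx.1, hJm hx.2⟩
  have hJh : 0 ≤ J h := hJ0 ▸ hJm (by linarith)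
  have hint : Integrable J μ := by
    refine Integrable.of_bound hJc.aestronglyMeasurable (J h) ?_
    filter_upwards [hmem] with x hx
    rw [Real.norm_of_nonneg hx.1]
    exact hx.2
  rw [hint.integral_eq_integral_Ioc_meas_le (M := J h) (hmem.mono fun _ hx => hx.1)
    (hmem.mono fun _ hx => hx.2)]
  have hkey : ∀ t ∈ Set.Ioc 0 (J h), μ.real {x | t ≤ J x} = Real.exp (-t) := by
    intro t ht
    have hsub : Set.Icc (J (-h)) (J h) ⊆ J '' Set.Icc (-h) h :=
      intermediate_value_Icc (by linarith) hJc.continuousOn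
    set S : Set ℝ := Set.Icc (-h) h ∩ J ⁻¹' {t} with hS
    have hSc : IsCompact S := isCompact_Icc.inter_right (isClosed_singleton.preimage hJc)
    have hSn : S.Nonempty := by
      obtain ⟨x, hx, hxt⟩ := hsub (show t ∈ _ from ⟨hJ0 ▸ ht.1.le, ht.2⟩)
      exact ⟨x, hx, hxt⟩
    -- `J` may have flat pieces, so the least `x` with `J x = t` is taken; then `{t ≤ J}` is `[x,
    -- ∞)` up to a null set.
    obtain ⟨x, hxS, hxmin⟩ := hSc.exists_isLeast hSn
    have hxt : J x = t := hxS.2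
    rw [← hxt, ← htail x hxS.1]
    refine measureReal_congr ?_
    filter_upwards [hμ] with y hy
    refine propext ⟨fun hxy => ?_, fun hxy => hJm hxy⟩
    by_contra hlt
    have hyx : y < x := not_le.1 hlt
    have : J y = J x := le_antisymm (hJm hyx.le) hxy
    exact absurd (hxmin ⟨hy, this.trans hxt⟩) (not_le.2 hyx)
  rw [setIntegral_congr_fun measurableSet_Ioc hkey, ← intervalIntegral.integral_of_le hJh,
    intervalIntegral.integral_comp_neg (fun t => Real.exp t), integral_exp]
  simp

section Potential

variable (m : Measure ℝ) [IsFiniteMeasure m]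

lemma monotone_measureReal_Iio : Monotone fun y => m.real (Set.Iio y) :=
  fun _ _ hab => measureReal_mono (Set.Iio_subset_Iio hab)

lemma continuous_measureReal_Iio [NullSingletonClass m] :
    Continuous fun y => m.real (Set.Iio y) := by
  have h : ∀ y, m.real (Set.Iio y) = ∫ t, (Set.Iio y).indicator (fun _ => (1 : ℝ)) t ∂m := by
    intro y
    rw [integral_indicator_const _ measurableSet_Iio, smul_eq_mul, mul_one]
  simp_rw [h]
  refine continuous_iff_continuousAt.2 fun y => ?_
  refine continuousAt_of_dominated (bound := fun _ => 1) (.of_forall fun z => ?_)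
    (.of_forall fun z => .of_forall fun t => ?_) (integrable_const _) ?_
  · exact (measurable_const.indicator measurableSet_Iio).aestronglyMeasurable
  · by_cases ht : t < z <;> simp [Set.indicator, ht]
  · have hne : ∀ᵐ t ∂m, t ≠ y := by simp [ae_iff]
    filter_upwards [hne] with t ht
    rcases ht.lt_or_gt with hlt | hgt
    · refine (continuousAt_const (y := (1 : ℝ))).congr ?_
      filter_upwards [lt_mem_nhds hlt] with z hz
      simp [hz]
    · refine (continuousAt_const (y := (0 : ℝ))).congr ?_
      filter_upwards [gt_mem_nhds hgt] with z hz
      simp [hz.le]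

/-- The mean number of points `t` of a Poisson process with intensity `m` satisfying `t < x + s`,
where `s` is distributed according to `μ`. -/
noncomputable def potential (μ : Measure ℝ) (x : ℝ) : ℝ := ∫ s, m.real (Set.Iio (x + s)) ∂μ

variable (μ : Measure ℝ) [IsProbabilityMeasure μ]

lemma integrable_measureReal_Iio {α : Type*} [MeasurableSpace α] (ρ : Measure α)
    [IsFiniteMeasure ρ] {f : α → ℝ} (hf : Measurable f) :
    Integrable (fun a => m.real (Set.Iio (f a))) ρ := by
  refine Integrable.of_bound
    ((monotone_measureReal_Iio m).measurable.comp hf).aestronglyMeasurable (m.real Set.univ)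
    (.of_forall fun a => ?_)
  rw [Real.norm_of_nonneg measureReal_nonneg]
  exact measureReal_mono (Set.subset_univ _)

lemma monotone_potential : Monotone (potential m μ) := fun x y hxy =>
  integral_mono (integrable_measureReal_Iio m μ (by fun_prop))
    (integrable_measureReal_Iio m μ (by fun_prop))
    fun s => monotone_measureReal_Iio m (add_le_add_left hxy s)

lemma continuous_potential [NullSingletonClass m] : Continuous (potential m μ) := by
  refine continuous_of_dominated (bound := fun _ => m.real Set.univ) (fun x => ?_)
    (fun x => .of_forall fun s => ?_) (integrable_const _) (.of_forall fun s => ?_)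
  · exact (integrable_measureReal_Iio m μ (by fun_prop)).aestronglyMeasurable
  · rw [Real.norm_of_nonneg measureReal_nonneg]
    exact measureReal_mono (Set.subset_univ _)
  · exact (continuous_measureReal_Iio m).comp (by fun_prop)

lemma integral_potential_comm (ν : Measure ℝ) [IsProbabilityMeasure ν] :
    ∫ x, potential m μ x ∂ν = ∫ x, potential m ν x ∂μ := by
  simp only [potential]
  rw [integral_integral_swap]
  · simp_rw [add_comm]
  · exact integrable_measureReal_Iio m (ν.prod μ) (f := fun p => p.1 + p.2) (by fun_prop)

/-- Fubini for the indicator of `t < x + s`. This is the form in which the potential comes out of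
the Poisson formula. -/
lemma potential_eq_integral (x : ℝ) :
    potential m μ x = ∫ t, μ.real (Set.Ioi (t - x)) ∂m := by
  have h1 : ∀ s, m.real (Set.Iio (x + s))
      = ∫ t, {p : ℝ × ℝ | p.2 < x + p.1}.indicator (fun _ => (1 : ℝ)) (s, t) ∂m := by
    intro s
    rw [← integral_indicator_one measurableSet_Iio]
    rfl
  have h2 : ∀ t, μ.real (Set.Ioi (t - x))
      = ∫ s, {p : ℝ × ℝ | p.2 < x + p.1}.indicator (fun _ => (1 : ℝ)) (s, t) ∂μ := by
    intro t
    rw [← integral_indicator_one measurableSet_Ioi]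
    refine integral_congr_ae (.of_forall fun s => ?_)
    simp only [Set.indicator, Set.mem_Ioi, Set.mem_ofPred_eq, sub_lt_iff_lt_add', Pi.one_apply]
  simp_rw [potential, h1, h2]
  refine integral_integral_swap ?_
  refine (integrable_const (1 : ℝ)).indicator (s := {p : ℝ × ℝ | p.2 < x + p.1}) ?_
  exact measurableSet_lt (by fun_prop) (by fun_prop)

end Potential

/-- Two laws whose tails are determined by the potentials of each other have potentials that agree
at the upper end point of the support. -/
lemma potential_eq_of_tails {m : Measure ℝ} [IsFiniteMeasure m] [NullSingletonClass m]
    (hm0 : m (Set.Iio 0) = 0) {h : ℝ} (hh : 0 ≤ h) {μ ν : Measure ℝ}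
    [IsProbabilityMeasure μ] [IsProbabilityMeasure ν]
    (hμ : ∀ᵐ x ∂μ, x ∈ Set.Icc (-h) h) (hν : ∀ᵐ x ∂ν, x ∈ Set.Icc (-h) h)
    (hμν : ∀ x ∈ Set.Ioc (-h) h, μ.real (Set.Ici x) = Real.exp (-potential m ν x))
    (hνμ : ∀ x ∈ Set.Ioc (-h) h, ν.real (Set.Ici x) = Real.exp (-potential m μ x)) :
    potential m μ h = potential m ν h := by
  have key : ∀ (μ ν : Measure ℝ) [IsProbabilityMeasure μ] [IsProbabilityMeasure ν],
      (∀ᵐ x ∂μ, x ∈ Set.Icc (-h) h) → (∀ᵐ x ∂ν, x ∈ Set.Icc (-h) h) →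
      (∀ x ∈ Set.Ioc (-h) h, μ.real (Set.Ici x) = Real.exp (-potential m ν x)) →
      ∫ x, potential m ν x ∂μ = 1 - Real.exp (-potential m ν h) := by
    intro μ ν _ _ hμ hν hμν
    have h0 : potential m ν (-h) = 0 := by
      refine integral_eq_zero_of_ae ?_
      filter_upwards [hν] with s hs
      refine le_antisymm ?_ measureReal_nonneg
      calc m.real (Set.Iio (-h + s)) ≤ m.real (Set.Iio 0) :=
            monotone_measureReal_Iio m (by linarith [hs.2])
        _ = 0 := by simp [Measure.real, hm0]
    refine integral_eq_one_sub_exp_neg hh hμ (continuous_potential m ν) (monotone_potential m ν)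
      h0 fun x hx => ?_
    -- The tail hypothesis omits the left end point `-h`, where values are truncated; there both
    -- sides equal `1`.
    rcases hx.1.eq_or_lt with rfl | hlt
    · rw [h0, neg_zero, Real.exp_zero]
      have : ∀ᵐ x ∂μ, x ∈ Set.Ici (-h) := hμ.mono fun _ hx => hx.1
      rw [Measure.real, (mem_ae_iff_prob_eq_one measurableSet_Ici).1 this]
      simp
    · exact hμν x ⟨hlt, hx.2⟩
  have h1 := key μ ν hμ hν hμν
  have h2 := key ν μ hν hμ hνμ
  rw [integral_potential_comm] at h1
  have h3 : Real.exp (-potential m ν h) = Real.exp (-potential m μ h) := by linarith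
  exact (neg_injective (Real.exp_injective h3)).symm

/-- Ordered random variables in `[-h, h]` with the same potential at `h` agree almost surely. -/
lemma ae_eq_of_potential_eq {α : Type*} [MeasurableSpace α] {Q : Measure α}
    [IsProbabilityMeasure Q] {m : Measure ℝ} [IsFiniteMeasure m] {h : ℝ}
    (hpos : ∀ a b, 0 ≤ a → a < b → b ≤ 2 * h → 0 < m (Set.Ico a b))
    {X Y : α → ℝ} (hX : Measurable X) (hY : Measurable Y) (hXY : ∀ a, X a ≤ Y a)
    (hXl : ∀ a, -h ≤ X a) (hYu : ∀ a, Y a ≤ h)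
    (heq : potential m (Q.map X) h = potential m (Q.map Y) h) : ∀ᵐ a ∂Q, X a = Y a := by
  have hmap : ∀ Z : α → ℝ, Measurable Z →
      potential m (Q.map Z) h = ∫ a, m.real (Set.Iio (h + Z a)) ∂Q := fun Z hZ =>
    integral_map hZ.aemeasurable
      ((monotone_measureReal_Iio m).measurable.comp (by fun_prop)).aestronglyMeasurable
  rw [hmap X hX, hmap Y hY] at heq
  have hae := (integral_eq_iff_of_ae_le (integrable_measureReal_Iio m Q (by fun_prop))
    (integrable_measureReal_Iio m Q (by fun_prop))
    (.of_forall fun a => monotone_measureReal_Iio m (add_le_add_right (hXY a) h))).1 heq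
  filter_upwards [hae] with a ha
  by_contra hne
  have hlt : X a < Y a := lt_of_le_of_ne (hXY a) hne
  -- Both end points lie in `[0, 2 * h]`, where `m` charges every nonempty interval `[a, b)`.
  have hp := hpos (h + X a) (h + Y a) (by linarith [hXl a]) (by linarith) (by linarith [hYu a])
  have hu : Set.Iio (h + Y a) = Set.Iio (h + X a) ∪ Set.Ico (h + X a) (h + Y a) :=
    (Set.Iio_union_Ico_eq_Iio (by linarith)).symm
  have hd : Disjoint (Set.Iio (h + X a)) (Set.Ico (h + X a) (h + Y a)) :=
    Set.disjoint_left.2 fun t h1 h2 => absurd h2.1 (not_le.2 h1)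
  rw [hu, measureReal_union hd measurableSet_Ico] at ha
  have : 0 < m.real (Set.Ico (h + X a) (h + Y a)) :=
    ENNReal.toReal_pos hp.ne' (measure_ne_top _ _)
  linarith

/-! ### The recursion on a fixed tree and its extreme solutions. -/

namespace WeightedTree

/-- The value of an individual with offspring `c` whose `i`-th child has value `f i`, when the
quitting penalty is `h` and values are truncated below at `-h`. -/
noncomputable def moveValue (h : ℝ) (c : PointConfig) (f : ℕ → ℝ) : ℝ :=
  max (-h) ((Finset.range c.1).fold min h fun i => c.2 i - f i)

lemma moveValue_mem_Icc {h : ℝ} (hh : 0 ≤ h) (c : PointConfig) (f : ℕ → ℝ) :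
    moveValue h c f ∈ Set.Icc (-h) h :=
  ⟨le_max_left _ _, max_le (by linarith) (Finset.fold_min_le _ |>.2 (.inl le_rfl))⟩

/-- Above `-h` the truncation plays no role, and the event splits into one condition per child; this
makes independence of the children usable. -/
lemma le_moveValue_iff {h x : ℝ} (hx : -h < x) (c : PointConfig) (f : ℕ → ℝ) :
    x ≤ moveValue h c f ↔ x ≤ h ∧ ∀ i < c.1, f i ≤ c.2 i - x := by
  simp only [moveValue, le_max_iff, not_le.2 hx, false_or, Finset.le_fold_min, Finset.mem_range]
  simp only [le_sub_comm]

lemma moveValue_anti (h : ℝ) (c : PointConfig) {f g : ℕ → ℝ} (hfg : ∀ i < c.1, f i ≤ g i) :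
    moveValue h c g ≤ moveValue h c f := by
  refine max_le_max le_rfl ((Finset.le_fold_min _).2 ⟨Finset.fold_min_le _ |>.2 (.inl le_rfl), ?_⟩)
  exact fun i hi => (Finset.fold_min_le _).2
    (.inr ⟨i, hi, sub_le_sub_left (hfg i (Finset.mem_range.1 hi)) _⟩)

lemma continuous_moveValue (h : ℝ) (c : PointConfig) : Continuous (moveValue h c) := by
  have : ∀ s : Finset ℕ, Continuous fun f : ℕ → ℝ => s.fold min h fun i => c.2 i - f i := by
    intro s
    induction s using Finset.induction_on with
    | empty => simpa using continuous_const
    | insert i s hi ih =>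
      simp_rw [Finset.fold_insert hi]
      fun_prop
  exact continuous_const.max (this _)

lemma measurable_moveValue (h : ℝ) :
    Measurable fun p : PointConfig × (ℕ → ℝ) => moveValue h p.1 p.2 := by
  refine measurable_of_Ici fun x => ?_
  by_cases hx : x ≤ -h
  · convert MeasurableSet.univ
    exact Set.eq_univ_of_forall fun p => hx.trans (le_max_left _ _)
  have : (fun p : PointConfig × (ℕ → ℝ) => moveValue h p.1 p.2) ⁻¹' Set.Ici x
      = {p | x ≤ h ∧ ∀ i < p.1.1, p.2 i ≤ p.1.2 i - x} := by
    ext p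
    exact le_moveValue_iff (not_le.1 hx) _ _
  rw [this]
  refine (MeasurableSet.const _).inter (MeasurableSet.congr (s := ⋂ i,
    ({p : PointConfig × (ℕ → ℝ) | p.1.1 ≤ i} ∪ {p | p.2 i ≤ p.1.2 i - x})) ?_ ?_)
  · refine MeasurableSet.iInter fun i => ?_
    exact (measurableSet_le (by fun_prop) (by fun_prop)).union
      (measurableSet_le (by fun_prop) (by fun_prop))
  · ext p
    simp only [Set.mem_iInter, Set.mem_union, Set.mem_ofPred_eq, ← not_lt, ← imp_iff_not_or]
    simp only [not_lt]
    rfl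

/-- The tree of the descendants of `u`. -/
def subtree (T : WeightedTree) (u : List ℕ) : WeightedTree := fun v => T (v ++ u)

lemma subtree_subtree_singleton (T : WeightedTree) (u : List ℕ) (i : ℕ) :
    (T.subtree u).subtree [i] = T.subtree (i :: u) := by
  funext v
  simp [subtree]

lemma measurable_subtree (u : List ℕ) : Measurable fun T : WeightedTree => T.subtree u :=
  measurable_pi_lambda _ fun _ => measurable_pi_apply _

/-- The value of the root when generation `n` is assigned the extreme value that is most favourable
(`b = false`) or least favourable (`b = true`) for the player to move at the root. -/
noncomputable def truncatedValue (h : ℝ) : ℕ → Bool → WeightedTree → ℝ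
  | 0, b, _ => if b then h else -h
  | n + 1, b, T => moveValue h (T []) fun i => truncatedValue h n (!b) (T.subtree [i])

lemma truncatedValue_mem_Icc {h : ℝ} (hh : 0 ≤ h) (n : ℕ) (b : Bool) (T : WeightedTree) :
    truncatedValue h n b T ∈ Set.Icc (-h) h := by
  cases n with
  | zero => cases b <;> simp [truncatedValue] <;> linarith
  | succ n => exact moveValue_mem_Icc hh _ _

lemma measurable_truncatedValue (h : ℝ) (n : ℕ) (b : Bool) :
    Measurable (truncatedValue h n b) := by
  induction n generalizing b with
  | zero => exact measurable_const
  | succ n ih =>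
    have hchild : Measurable fun (T : WeightedTree) (i : ℕ) =>
        truncatedValue h n (!b) (T.subtree [i]) :=
      measurable_pi_lambda _ fun i => (ih _).comp (measurable_subtree _)
    have hroot : Measurable fun T : WeightedTree => T [] := measurable_pi_apply []
    exact (measurable_moveValue h).comp (hroot.prodMk hchild)

/-- Since `moveValue` is antitone in the children's values, each inequality at one level yields the
other at the next, so both go through a joint induction. -/
lemma truncatedValue_succ {h : ℝ} (hh : 0 ≤ h) (n : ℕ) (T : WeightedTree) :
    truncatedValue h n false T ≤ truncatedValue h (n + 1) false T ∧
      truncatedValue h (n + 1) true T ≤ truncatedValue h n true T := by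
  induction n generalizing T with
  | zero => exact ⟨(truncatedValue_mem_Icc hh 1 _ T).1, (truncatedValue_mem_Icc hh 1 _ T).2⟩
  | succ n ih =>
    exact ⟨moveValue_anti h _ fun i _ => (ih _).2, moveValue_anti h _ fun i _ => (ih _).1⟩

lemma truncatedValue_false_le_true {h : ℝ} (hh : 0 ≤ h) (n : ℕ) (T : WeightedTree) :
    truncatedValue h n false T ≤ truncatedValue h n true T := by
  induction n generalizing T with
  | zero => simp [truncatedValue]; linarith
  | succ n ih => exact moveValue_anti h _ fun i _ => ih _

/-- The limit of the lower truncated values. -/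
noncomputable def lowerValue (h : ℝ) (T : WeightedTree) : ℝ := ⨆ n, truncatedValue h n false T

/-- The limit of the upper truncated values. -/
noncomputable def upperValue (h : ℝ) (T : WeightedTree) : ℝ := ⨅ n, truncatedValue h n true T

lemma measurable_lowerValue (h : ℝ) : Measurable (lowerValue h) :=
  Measurable.iSup fun n => measurable_truncatedValue h n _

lemma measurable_upperValue (h : ℝ) : Measurable (upperValue h) :=
  Measurable.iInf fun n => measurable_truncatedValue h n _

lemma tendsto_lowerValue {h : ℝ} (hh : 0 ≤ h) (T : WeightedTree) :
    Filter.Tendsto (fun n => truncatedValue h n false T) Filter.atTop (nhds (lowerValue h T)) :=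
  tendsto_atTop_ciSup (monotone_nat_of_le_succ fun n => (truncatedValue_succ hh n T).1)
    ⟨h, Set.forall_mem_range.2 fun n => (truncatedValue_mem_Icc hh n _ T).2⟩

lemma tendsto_upperValue {h : ℝ} (hh : 0 ≤ h) (T : WeightedTree) :
    Filter.Tendsto (fun n => truncatedValue h n true T) Filter.atTop (nhds (upperValue h T)) :=
  tendsto_atTop_ciInf (antitone_nat_of_succ_le fun n => (truncatedValue_succ hh n T).2)
    ⟨-h, Set.forall_mem_range.2 fun n => (truncatedValue_mem_Icc hh n _ T).1⟩

lemma lowerValue_mem_Icc {h : ℝ} (hh : 0 ≤ h) (T : WeightedTree) :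
    lowerValue h T ∈ Set.Icc (-h) h :=
  isClosed_Icc.mem_of_tendsto (tendsto_lowerValue hh T)
    (.of_forall fun n => truncatedValue_mem_Icc hh n _ T)

lemma upperValue_mem_Icc {h : ℝ} (hh : 0 ≤ h) (T : WeightedTree) :
    upperValue h T ∈ Set.Icc (-h) h :=
  isClosed_Icc.mem_of_tendsto (tendsto_upperValue hh T)
    (.of_forall fun n => truncatedValue_mem_Icc hh n _ T)

lemma lowerValue_le_upperValue {h : ℝ} (hh : 0 ≤ h) (T : WeightedTree) :
    lowerValue h T ≤ upperValue h T :=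
  le_of_tendsto_of_tendsto' (tendsto_lowerValue hh T) (tendsto_upperValue hh T)
    fun n => truncatedValue_false_le_true hh n T

lemma lowerValue_eq_moveValue {h : ℝ} (hh : 0 ≤ h) (T : WeightedTree) :
    lowerValue h T = moveValue h (T []) fun i => upperValue h (T.subtree [i]) :=
  tendsto_nhds_unique ((Filter.tendsto_add_atTop_iff_nat 1).2 (tendsto_lowerValue hh T))
    (((continuous_moveValue h (T [])).tendsto _).comp
      (tendsto_pi_nhds.2 fun _ => tendsto_upperValue hh _))

lemma upperValue_eq_moveValue {h : ℝ} (hh : 0 ≤ h) (T : WeightedTree) :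
    upperValue h T = moveValue h (T []) fun i => lowerValue h (T.subtree [i]) :=
  tendsto_nhds_unique ((Filter.tendsto_add_atTop_iff_nat 1).2 (tendsto_upperValue hh T))
    (((continuous_moveValue h (T [])).tendsto _).comp
      (tendsto_pi_nhds.2 fun _ => tendsto_lowerValue hh _))

/-! ### Game valuations lie between the two extreme values. -/

section Valuations

variable {T : WeightedTree} {lam : ℝ} {f : T.Vertex → ℝ}

/-- The values of `f` at the children of `u`, padded with zeros. -/
noncomputable def childValue (f : T.Vertex → ℝ) (u : T.Vertex) (i : ℕ) : ℝ :=
  if hi : i < T.numChildren u.1 then f (u.child ⟨i, hi⟩) else 0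

lemma childValue_of_lt (f : T.Vertex → ℝ) (u : T.Vertex) {i : ℕ} (hi : i < T.numChildren u.1) :
    childValue f u i = f (u.child ⟨i, hi⟩) :=
  dif_pos hi

lemma isLeast_iff_eq_fold (u : T.Vertex) (h y : ℝ) :
    IsLeast (insert h (Set.range fun i : Fin (T.numChildren u.1) =>
      T.cost u.1 i - f (u.child i))) y ↔
      y = (Finset.range (T u.1).1).fold min h fun i => (T u.1).2 i - childValue f u i := by
  set m := (Finset.range (T u.1).1).fold min h fun i => (T u.1).2 i - childValue f u i with hm
  suffices hleast : IsLeast (insert h (Set.range fun i : Fin (T.numChildren u.1) =>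
      T.cost u.1 i - f (u.child i))) m from
    ⟨fun hy => hy.unique hleast, fun hy => hy ▸ hleast⟩
  have hlow : m ≤ h ∧ ∀ i ∈ Finset.range (T u.1).1, m ≤ (T u.1).2 i - childValue f u i :=
    (Finset.le_fold_min _).1 hm.le
  refine ⟨?_, ?_⟩
  · rcases (Finset.fold_min_le _).1 hm.ge with h1 | ⟨i, hi, h1⟩
    · exact Set.mem_insert_iff.2 (.inl (le_antisymm hlow.1 h1))
    · refine Set.mem_insert_iff.2 (.inr ⟨⟨i, Finset.mem_range.1 hi⟩, ?_⟩)
      rw [le_antisymm (hlow.2 i hi) h1, childValue_of_lt f u (Finset.mem_range.1 hi)]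
      rfl
  · rintro y (rfl | ⟨i, rfl⟩)
    · exact hlow.1
    · have := hlow.2 i.1 (Finset.mem_range.2 i.2)
      rwa [childValue_of_lt f u i.2] at this

lemma IsGameValuation.eq_moveValue (hf : T.IsGameValuation lam f) (u : T.Vertex) :
    f u = moveValue (lam / 2) (T u.1) (childValue f u) := by
  have h1 := (isLeast_iff_eq_fold u _ _).1 (hf u).2
  rw [moveValue, ← h1, max_eq_right (hf u).1.1]

lemma IsGameValuation.mem_Icc_truncatedValue (hf : T.IsGameValuation lam f)
    (n : ℕ) (u : T.Vertex) :
    truncatedValue (lam / 2) n false (T.subtree u.1) ≤ f u ∧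
      f u ≤ truncatedValue (lam / 2) n true (T.subtree u.1) := by
  induction n generalizing u with
  | zero => exact (hf u).1
  | succ n ih =>
    rw [hf.eq_moveValue u]
    have hc : ∀ i < (T u.1).1,
        truncatedValue (lam / 2) n false ((T.subtree u.1).subtree [i]) ≤ childValue f u i ∧
        childValue f u i ≤ truncatedValue (lam / 2) n true ((T.subtree u.1).subtree [i]) := by
      intro i hi
      rw [subtree_subtree_singleton, childValue_of_lt f u hi]
      exact ih (u.child ⟨i, hi⟩)
    exact ⟨moveValue_anti _ _ fun i hi => (hc i hi).2, moveValue_anti _ _ fun i hi => (hc i hi).1⟩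

lemma IsGameValuation.lowerValue_le (hlam : 0 < lam) (hf : T.IsGameValuation lam f)
    (u : T.Vertex) : lowerValue (lam / 2) (T.subtree u.1) ≤ f u :=
  le_of_tendsto' (tendsto_lowerValue (by positivity) _)
    fun n => (hf.mem_Icc_truncatedValue n u).1

lemma IsGameValuation.le_upperValue (hlam : 0 < lam) (hf : T.IsGameValuation lam f)
    (u : T.Vertex) : f u ≤ upperValue (lam / 2) (T.subtree u.1) :=
  ge_of_tendsto' (tendsto_upperValue (by positivity) _)
    fun n => (hf.mem_Icc_truncatedValue n u).2

lemma isGameValuation_lowerValue (hlam : 0 < lam)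
    (hcost : ∀ u, ∀ i < (T u).1, 0 ≤ (T u).2 i)
    (heq : ∀ u, lowerValue (lam / 2) (T.subtree u) = upperValue (lam / 2) (T.subtree u)) :
    T.IsGameValuation lam fun u => lowerValue (lam / 2) (T.subtree u.1) := by
  have hh : 0 ≤ lam / 2 := by positivity
  intro u
  refine ⟨lowerValue_mem_Icc hh _, (isLeast_iff_eq_fold
    (f := fun u : T.Vertex => lowerValue (lam / 2) (T.subtree u.1)) u _ _).2 ?_⟩
  dsimp only
  rw [lowerValue_eq_moveValue hh, moveValue]
  -- The recursion for `lowerValue` has `upperValue` at the children; only their equality makes it a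
  -- game valuation.
  simp_rw [subtree_subtree_singleton, ← heq]
  have hfold : (Finset.range (T.subtree u.1 []).1).fold min (lam / 2)
        (fun i => (T.subtree u.1 []).2 i - lowerValue (lam / 2) (T.subtree (i :: u.1)))
      = (Finset.range (T u.1).1).fold min (lam / 2) fun i => (T u.1).2 i -
        childValue (fun u : T.Vertex => lowerValue (lam / 2) (T.subtree u.1)) u i := by
    refine Finset.fold_congr fun i hi => ?_
    rw [childValue_of_lt _ u (Finset.mem_range.1 hi)]
    rfl
  -- The truncation at `-(lam / 2)` is inactive: costs are nonnegative and the children's values are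
  -- at most `lam / 2`.
  rw [hfold, max_eq_right]
  refine (Finset.le_fold_min _).2 ⟨by linarith, fun i hi => ?_⟩
  have h1 := hcost u.1 i (Finset.mem_range.1 hi)
  rw [childValue_of_lt _ u (Finset.mem_range.1 hi)]
  have h2 := (lowerValue_mem_Icc hh (T.subtree (u.child ⟨i, Finset.mem_range.1 hi⟩).1)).2
  linarith

lemma IsGameValuation.eq_lowerValue (hlam : 0 < lam) (hf : T.IsGameValuation lam f)
    (heq : ∀ u, lowerValue (lam / 2) (T.subtree u) = upperValue (lam / 2) (T.subtree u)) :
    f = fun u => lowerValue (lam / 2) (T.subtree u.1) :=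
  funext fun u => le_antisymm ((hf.le_upperValue hlam u).trans_eq (heq u.1).symm)
    (hf.lowerValue_le hlam u)

lemma altLE_refl (f : T.Vertex → ℝ) : T.AltLE f f := fun _ => ⟨fun _ => le_rfl, fun _ => le_rfl⟩

end Valuations

end WeightedTree

/-! ### The law of the tree and of its extreme values. -/

namespace WeightedTree

section Law

variable (ν : Measure PointConfig) [IsProbabilityMeasure ν]

/-- The law of a tree with independent offspring distributed according to `ν`. -/
noncomputable abbrev law : Measure WeightedTree := Measure.infinitePi fun _ : List ℕ => ν

lemma map_subtree_law (u : List ℕ) : (law ν).map (fun T => T.subtree u) = law ν :=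
  Measure.map_infinitePi_infinitePi_of_inj (P := fun _ : List ℕ => ν)
    (List.append_left_injective u)

/-- The pairs `(i, v)` give distinct labels `v ++ [i]`, so the subtrees at the children use disjoint
families of independent offspring. -/
lemma map_subtrees_law :
    (law ν).map (fun T (i : ℕ) => T.subtree [i]) = Measure.infinitePi fun _ : ℕ => law ν := by
  have hinj : Function.Injective fun p : ℕ × List ℕ => p.2 ++ [p.1] := by
    rintro ⟨i, u⟩ ⟨j, v⟩ huv
    have := List.append_inj' huv rfl
    grind
  have h1 := Measure.map_infinitePi_infinitePi_of_inj (P := fun _ : List ℕ => ν) hinj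
  have h2 := Measure.infinitePi_map_curry fun (_ : ℕ) (_ : List ℕ) => ν
  rw [← h1, Measure.map_map (MeasurableEquiv.measurable _) (by fun_prop)] at h2
  exact h2

lemma indepFun_root_subtrees :
    IndepFun (fun T : WeightedTree => T []) (fun T (i : ℕ) => T.subtree [i]) (law ν) := by
  have hind : iIndepFun (fun (u : List ℕ) (T : WeightedTree) => T u) (law ν) :=
    iIndepFun_infinitePi (P := fun _ : List ℕ => ν) (X := fun _ c => c) fun _ => measurable_id
  have h := indep_iSup_of_disjoint (fun u => (measurable_pi_apply u).comap_le)
    hind (S := {[]}) (T := {u | u ≠ []}) (Set.disjoint_left.2 fun u h1 h2 => h2 h1)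
  refine indep_of_indep_of_le_left (indep_of_indep_of_le_right h ?_) ?_
  · rw [← measurable_iff_comap_le]
    refine @measurable_pi_lambda _ _ _ (_) _ _ fun i =>
      @measurable_pi_lambda _ _ _ (_) _ _ fun v => ?_
    rw [measurable_iff_comap_le]
    exact le_iSup₂_of_le (f := fun u (_ : u ∈ {u : List ℕ | u ≠ []}) =>
      MeasurableSpace.comap (fun T : WeightedTree => T u) inferInstance) (v ++ [i]) (by simp) le_rfl
  · exact le_iSup₂_of_le (f := fun u (_ : u ∈ ({[]} : Set (List ℕ))) =>
      MeasurableSpace.comap (fun T : WeightedTree => T u) inferInstance) [] rfl le_rfl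

lemma map_root_values_law {G : WeightedTree → ℝ} (hG : Measurable G) :
    (law ν).map (fun T => (T [], fun i : ℕ => G (T.subtree [i])))
      = ν.prod (Measure.infinitePi fun _ : ℕ => (law ν).map G) := by
  have hsub : Measurable fun (T : WeightedTree) (i : ℕ) => T.subtree [i] :=
    measurable_pi_lambda _ fun i => measurable_subtree [i]
  have hpi : Measurable fun (S : ℕ → WeightedTree) (i : ℕ) => G (S i) := by fun_prop
  have hind := (indepFun_root_subtrees ν).comp measurable_id hpi
  have h := (indepFun_iff_map_prod_eq_prod_map_map
    (measurable_id.comp (measurable_pi_apply [])).aemeasurable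
    (hpi.comp hsub).aemeasurable).1 hind
  rw [← Measure.map_map hpi hsub, map_subtrees_law,
    Measure.infinitePi_map_pi (fun _ : ℕ => law ν) fun _ => hG] at h
  refine h.trans ?_
  congr 1
  exact Measure.infinitePi_map_eval (fun _ : List ℕ => ν) []

/-- Conditionally on the root's offspring `c`, the values `G` of the subtrees are independent and
identically distributed; only the indices below `c.1` are constrained. -/
lemma measureReal_le_moveValue {G : WeightedTree → ℝ} (hG : Measurable G) {h x : ℝ}
    (hx : x ∈ Set.Ioc (-h) h) :
    (law ν).real {T | x ≤ moveValue h (T []) fun i => G (T.subtree [i])}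
      = ∫ c, ∏ i ∈ Finset.range c.1, ((law ν).map G).real (Set.Iic (c.2 i - x)) ∂ν := by
  have := Measure.isProbabilityMeasure_map (μ := law ν) hG.aemeasurable
  set A : Set (PointConfig × (ℕ → ℝ)) := {p | x ≤ moveValue h p.1 p.2} with hA
  have hAm : MeasurableSet A := measurableSet_le measurable_const (measurable_moveValue h)
  have hsub : Measurable fun T : WeightedTree => (T [], fun i : ℕ => G (T.subtree [i])) := by
    have hroot : Measurable fun T : WeightedTree => T [] := measurable_pi_apply []
    exact hroot.prodMk (measurable_pi_lambda _ fun i => hG.comp (measurable_subtree [i]))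
  have h1 : (law ν).real {T | x ≤ moveValue h (T []) fun i => G (T.subtree [i])}
      = (ν.prod (Measure.infinitePi fun _ : ℕ => (law ν).map G)).real A := by
    rw [← map_root_values_law ν hG, map_measureReal_apply hsub hAm]
    rfl
  rw [h1, Measure.real, Measure.prod_apply hAm, ← integral_toReal
    (measurable_measure_prodMk_left hAm).aemeasurable (.of_forall fun _ => measure_lt_top _ _)]
  refine integral_congr_ae (.of_forall fun c => ?_)
  have hsec : Prod.mk c ⁻¹' A
      = Set.pi (Finset.range c.1 : Set ℕ) fun i => Set.Iic (c.2 i - x) := by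
    ext f
    simp [hA, le_moveValue_iff hx.1, hx.2]
  simp only [hsec, Measure.real]
  rw [Measure.infinitePi_pi _ fun i _ => measurableSet_Iic, ENNReal.toReal_prod]

lemma measureReal_Ici_map_of_eq_moveValue {m : Measure ℝ} (hν : IsPoissonProcess m id ν)
    {F G : WeightedTree → ℝ} (hF : Measurable F) (hG : Measurable G) {h : ℝ}
    (hFG : ∀ T, F T = moveValue h (T []) fun i => G (T.subtree [i])) :
    ∀ x ∈ Set.Ioc (-h) h, ((law ν).map F).real (Set.Ici x)
      = Real.exp (-potential m ((law ν).map G) x) := by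
  intro x hx
  have := Measure.isProbabilityMeasure_map (μ := law ν) hG.aemeasurable
  have := hν.isFiniteMeasure
  set g : ℝ → ℝ := fun t => ((law ν).map G).real (Set.Iic (t - x)) with hg
  have hgm : Measurable g := by
    refine Monotone.measurable fun a b hab => measureReal_mono (Set.Iic_subset_Iic.2 ?_)
    linarith
  have h1 := measureReal_le_moveValue ν hG hx
  have h2 := hν.integral_prod_eq_exp hgm fun t => ⟨measureReal_nonneg, measureReal_le_one⟩
  rw [map_measureReal_apply hF measurableSet_Ici, potential_eq_integral]
  have h3 : F ⁻¹' Set.Ici x = {T | x ≤ moveValue h (T []) fun i => G (T.subtree [i])} := by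
    ext T
    simp [hFG T]
  rw [h3, h1]
  refine h2.trans ?_
  congr 2
  refine integral_congr_ae (.of_forall fun t => ?_)
  have hc : Set.Ioi (t - x) = (Set.Iic (t - x))ᶜ := Set.compl_Iic.symm
  simp only [hg]
  rw [hc, probReal_compl_eq_one_sub measurableSet_Iic]

lemma ae_lowerValue_eq_upperValue {m : Measure ℝ} [NullSingletonClass m]
    (hν : IsPoissonProcess m id ν) (hm0 : m (Set.Iio 0) = 0) {h : ℝ} (hh : 0 ≤ h)
    (hpos : ∀ a b, 0 ≤ a → a < b → b ≤ 2 * h → 0 < m (Set.Ico a b)) :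
    ∀ᵐ T ∂(law ν), lowerValue h T = upperValue h T := by
  have hL := measurable_lowerValue h
  have hU := measurable_upperValue h
  have := Measure.isProbabilityMeasure_map (μ := law ν) hL.aemeasurable
  have := Measure.isProbabilityMeasure_map (μ := law ν) hU.aemeasurable
  have := hν.isFiniteMeasure
  refine ae_eq_of_potential_eq hpos hL hU (lowerValue_le_upperValue hh)
    (fun T => (lowerValue_mem_Icc hh T).1) (fun T => (upperValue_mem_Icc hh T).2) ?_
  refine potential_eq_of_tails hm0 hh ?_ ?_
    (measureReal_Ici_map_of_eq_moveValue ν hν hL hU (lowerValue_eq_moveValue hh))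
    (measureReal_Ici_map_of_eq_moveValue ν hν hU hL (upperValue_eq_moveValue hh))
  · exact (ae_map_iff hL.aemeasurable measurableSet_Icc).2 (.of_forall (lowerValue_mem_Icc hh))
  · exact (ae_map_iff hU.aemeasurable measurableSet_Icc).2 (.of_forall (upperValue_mem_Icc hh))

end Law

end WeightedTree

/-! ### Transfer to the given probability space. -/

lemma IsPoissonProcess.map_id {Ω : Type*} [MeasurableSpace Ω] {P : Measure Ω}
    [IsProbabilityMeasure P] {m : Measure ℝ} {η : Ω → PointConfig} (hη : IsPoissonProcess m η P) :
    IsPoissonProcess m id (P.map η) where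
  isFiniteMeasure := hη.isFiniteMeasure
  measurable := measurable_id
  count_hasLaw B hB := by
    have hc := PointConfig.measurable_count hB
    refine ⟨hc.aemeasurable, ?_⟩
    have := (hη.count_hasLaw B hB).map_eq
    exact (Measure.map_map hc hη.measurable).trans this
  count_iIndepFun k B hB hd := by
    have := Measure.isProbabilityMeasure_map (μ := P) hη.measurable.aemeasurable
    have hc := fun j => PointConfig.measurable_count (hB j)
    have h := hη.count_iIndepFun k B hB hd
    replace h := (iIndepFun_iff_map_fun_eq_pi_map
      fun j => ((hc j).comp hη.measurable).aemeasurable).1 h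
    refine (iIndepFun_iff_map_fun_eq_pi_map fun j => (hc j).aemeasurable).2 ?_
    have hcm : Measurable fun (c : PointConfig) (j : Fin k) => c.count (B j) :=
      measurable_pi_lambda _ hc
    refine (Measure.map_map hcm hη.measurable).trans (h.trans ?_)
    congr 1
    funext j
    exact (Measure.map_map (hc j) hη.measurable).symm

theorem proposition2 {Ω : Type*} [MeasurableSpace Ω] (P : Measure Ω) [IsProbabilityMeasure P]
    (q lam : ℝ) (hq0 : 0 < q) (hq1 : q < 1) (hlam : 0 < lam)
    (T : List ℕ → Ω → PointConfig) (hT : IsPoissonGaltonWatsonTree q lam T P) :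
    ∀ᵐ ω ∂P,
      (∃! f : (treeAt T ω).Vertex → ℝ, (treeAt T ω).IsGameValuation lam f) ∧
      ∃ fA fB : (treeAt T ω).Vertex → ℝ,
        (treeAt T ω).IsAliceValuation lam fA ∧ (treeAt T ω).IsBobValuation lam fB ∧ fA = fB := by
  have hmeas : ∀ u, Measurable (T u) := fun u => (hT.isPoissonProcess u).measurable
  have htree : Measurable (treeAt T) := measurable_pi_lambda _ hmeas
  have hprob := Measure.isProbabilityMeasure_map (μ := P) (hmeas []).aemeasurable
  have hlaw : P.map (treeAt T) = WeightedTree.law (P.map (T [])) := by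
    refine (hT.iIndepFun.map_fun_eq_infinitePi_map hmeas).trans ?_
    congr 1
    funext u
    exact (hT.identDistrib u).map_eq
  have hroot := WeightedTree.ae_lowerValue_eq_upperValue (P.map (T []))
    (hT.isPoissonProcess []).map_id (offspringIntensity_Iio_zero q lam) (h := lam / 2)
    (by positivity) fun a b ha hab hb => offspringIntensity_Ico_pos hq0 ha hab (by linarith)
  have heq : ∀ᵐ ω ∂P, ∀ u, WeightedTree.lowerValue (lam / 2) ((treeAt T ω).subtree u)
      = WeightedTree.upperValue (lam / 2) ((treeAt T ω).subtree u) := by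
    -- There are countably many labels, and the subtree at each, whether or not it is a vertex, has
    -- the law of the whole tree.
    refine ae_all_iff.2 fun u => ?_
    rw [← WeightedTree.map_subtree_law _ u, ← hlaw,
      Measure.map_map (WeightedTree.measurable_subtree u) htree] at hroot
    exact ae_of_ae_map ((WeightedTree.measurable_subtree u).comp htree).aemeasurable hroot
  have hcost : ∀ᵐ ω ∂P, ∀ u, ∀ i < (T u ω).1, (T u ω).2 i ∉ Set.Iio (0 : ℝ) :=
    ae_all_iff.2 fun u => (hT.isPoissonProcess u).ae_forall_notMem measurableSet_Iio
      (offspringIntensity_Iio_zero q lam)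
  filter_upwards [heq, hcost] with ω hω hc
  have hval := WeightedTree.isGameValuation_lowerValue hlam
    (fun u i hi => not_lt.1 (hc u i hi)) hω
  have huniq : ∀ f : (treeAt T ω).Vertex → ℝ, (treeAt T ω).IsGameValuation lam f → f = _ :=
    fun f hf => hf.eq_lowerValue hlam hω
  have hext : ∀ g : (treeAt T ω).Vertex → ℝ, (treeAt T ω).IsGameValuation lam g → _ = g :=
    fun g hg => (huniq g hg).symm
  exact ⟨⟨_, hval, huniq⟩, _, _, ⟨hval, fun g hg => hext g hg ▸ WeightedTree.altLE_refl _⟩,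
    ⟨hval, fun g hg => hext g hg ▸ WeightedTree.altLE_refl _⟩, rfl⟩
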